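/- Let $n\ge 2$ and $k\ge 1$ be integers, $\lambda\ge 0$, $M>0$, $\alpha\in(0,1]$, and let $f:[0,1]\to\mathbb{R}$ satisfy $|f(x)-f(y)|\le M|x-y|^{\alpha}$ for all $x,y\in[0,1]$. Let $x_i=\frac{i-1}{n-1}$ for $i=1,\dots,n$, and let $y_i=(f(x_i)+\eta_i)\bmod 1$ be noisy modulo-$1$ samples of $f$ with arbitrary $\eta_i\in\mathbb{R}$. Put $h_i=\exp(2\pi\iota f(x_i))$, $z_i=\exp(2\pi\iota y_i)$ (with $\iota=\sqrt{-1}$), and $$\bar{\mathbf h}=\begin{pmatrix}\mathrm{Re}(\mathbf h)\\ \mathrm{Im}(\mathbf h)\end{pmatrix},\qquad \bar{\mathbf z}=\begin{pmatrix}\mathrm{Re}(\mathbf z)\\ \mathrm{Im}(\mathbf z)\end{pmatrix}\in\mathbb{R}^{2n}.$$ Let $L\in\mathbb{R}^{n\times n}$ be the Laplacian matrix of the graph on $\{1,\dots,n\}$ in which distinct $i,j$ are adjacent if and only if $|i-j|\le k$, let $H=\begin{pmatrix}\lambda L&0\\0&\lambda L\end{pmatrix}\in\mathbb{R}^{2n\times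 2n}$, and let $\mathcal N(H)$ be the null space of $H$. Assume that $\|\bar{\mathbf z}-\bar{\mathbf h}\|_2\le\delta\sqrt n$ for some $\delta\in[0,1]$. Consider the problem $$\min_{\bar{\mathbf g}\in\mathbb{R}^{2n}:\ \|\bar{\mathbf g}\|_2^2=n}\ \bar{\mathbf g}^{T}H\bar{\mathbf g}-2\bar{\mathbf g}^{T}\bar{\mathbf z}.\qquad (P)$$ (1) If $\bar{\mathbf z}$ is not orthogonal to $\mathcal N(H)$, then $(P)$ has a unique solution $\hat{\mathbf g}$, and it satisfies $$\frac1n\langle\bar{\mathbf h},\hat{\mathbf g}\rangle\ \ge\ 1-\frac{3\delta}{2}-\frac{\lambda\pi^2M^2(2k)^{2\alpha+1}}{n^{2\alpha}}+\frac{1}{(4\lambda k+1)^2}\left(\frac{1}{2n}\bar{\mathbf z}^{T}H\bar{\mathbf z}\right).$$ (2) If $\bar{\mathbf z}\perp\mathcal N(H)$ and $\lambda<\frac{1}{4k}$, then $(P)$ has a unique solution $\hat{\mathbf g}$, and it satisfies $$\frac1n\langle\bar{\mathbf h},\hat{\mathbf g}\rangle\ \ge\ 1-\frac{3\delta}{2}-\frac{\lambda\pi^2M^2(2k)^{2\alpha+1}}{n^{2\alpha}}+\frac{1}{\left(1+4\lambda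 k-4\lambda k\sin^2\left(\frac{\pi}{2n}\right)\right)^2}\left(\frac{1}{2n}\bar{\mathbf z}^{T}H\bar{\mathbf z}\right).$$ -/

import Mathlib

noncomputable section

namespace ModuloDenoise

/-- The uniform grid on `[0,1]`: the points `i / (n - 1)`, `i = 0, …, n - 1`. -/
def grid (n : ℕ) (i : Fin n) : ℝ := (i : ℝ) / ((n : ℝ) - 1)

/-- The clean signal on the unit circle, `h_i = exp (2 π ι f(x_i))`. -/
def cleanSignal (n : ℕ) (f : ℝ → ℝ) (i : Fin n) : ℂ :=
  Complex.exp (2 * Real.pi * Complex.I * (f (grid n i) : ℂ))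

/-- The noisy modulo 1 samples `y_i = (f(x_i) + η_i) mod 1`. -/
def noisySample (n : ℕ) (f : ℝ → ℝ) (η : Fin n → ℝ) (i : Fin n) : ℝ :=
  Int.fract (f (grid n i) + η i)

/-- The noisy signal on the unit circle, `z_i = exp (2 π ι y_i)`. -/
def noisySignal (n : ℕ) (f : ℝ → ℝ) (η : Fin n → ℝ) (i : Fin n) : ℂ :=
  Complex.exp (2 * Real.pi * Complex.I * (noisySample n f η i : ℂ))

/-- The real version `(Re g, Im g)` of a complex vector `g`, with the Euclidean structure
of `ℝ^(2n)`. -/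
def realify {n : ℕ} (g : Fin n → ℂ) : EuclideanSpace ℝ (Fin n ⊕ Fin n) :=
  WithLp.toLp 2 (Sum.elim (fun i => (g i).re) (fun i => (g i).im))

/-- The nearest neighbour graph on `n` vertices: distinct `i`, `j` are adjacent iff
`|i - j| ≤ k`. -/
def nnGraph (n k : ℕ) : SimpleGraph (Fin n) where
  Adj i j := i ≠ j ∧ |((i : ℕ) : ℤ) - ((j : ℕ) : ℤ)| ≤ (k : ℤ)
  symm := ⟨fun i j h => ⟨h.1.symm, by rw [abs_sub_comm]; exact h.2⟩⟩
  loopless := ⟨fun _ h => h.1 rfl⟩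

instance (n k : ℕ) : DecidableRel (nnGraph n k).Adj := fun i j =>
  inferInstanceAs (Decidable (i ≠ j ∧ |((i : ℕ) : ℤ) - ((j : ℕ) : ℤ)| ≤ (k : ℤ)))

/-- The block-diagonal regularization matrix `H = diag (lam L, lam L)`, where `L` is the Laplacian
of the nearest neighbour graph. -/
def regMatrix (n k : ℕ) (lam : ℝ) : Matrix (Fin n ⊕ Fin n) (Fin n ⊕ Fin n) ℝ :=
  Matrix.fromBlocks (lam • (nnGraph n k).lapMatrix ℝ) 0 0 (lam • (nnGraph n k).lapMatrix ℝ)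

/-- The quadratic form `gᵀ H g`. -/
def quadForm {n : ℕ} (H : Matrix (Fin n ⊕ Fin n) (Fin n ⊕ Fin n) ℝ)
    (g : EuclideanSpace ℝ (Fin n ⊕ Fin n)) : ℝ :=
  inner ℝ g (Matrix.toEuclideanLin H g)

/-- The null space of `H`. -/
def nullSpace {n : ℕ} (H : Matrix (Fin n ⊕ Fin n) (Fin n ⊕ Fin n) ℝ) :
    Submodule ℝ (EuclideanSpace ℝ (Fin n ⊕ Fin n)) :=
  LinearMap.ker (Matrix.toEuclideanLin H)

/-- The objective `gᵀ H g - 2 gᵀ z`. -/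
def objective {n : ℕ} (H : Matrix (Fin n ⊕ Fin n) (Fin n ⊕ Fin n) ℝ)
    (z g : EuclideanSpace ℝ (Fin n ⊕ Fin n)) : ℝ :=
  quadForm H g - 2 * inner ℝ g z

/-- `g` is a (global) solution of the trust-region problem: minimize `gᵀ H g - 2 gᵀ z` subject to
`‖g‖² = n`. -/
def IsSolution {n : ℕ} (H : Matrix (Fin n ⊕ Fin n) (Fin n ⊕ Fin n) ℝ)
    (z g : EuclideanSpace ℝ (Fin n ⊕ Fin n)) : Prop :=
  ‖g‖ ^ 2 = (n : ℝ) ∧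
    ∀ g' : EuclideanSpace ℝ (Fin n ⊕ Fin n), ‖g'‖ ^ 2 = (n : ℝ) →
      objective H z g ≤ objective H z g'

end ModuloDenoise

end

/-
A minimizer `g` of `⟪x, H x⟫ - 2 ⟪x, z⟫` on the sphere of radius `‖z‖` satisfies `H g + μ g = z`
with `H + μ` positive semidefinite. As `H` is singular, `μ ≥ 0`, and `μ = 0` would make `z` a value
of `H` on the sphere, which is impossible if `z` is not orthogonal to the null space or `‖H‖ < 1`.
With `μ > 0` the minimizer is unique, and `μ ≤ 1` gives `⟪z, H z⟫ ≤ (‖H‖ + 1)² ⟪g, H g⟫`. Comparing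
the objective at `g` and at the clean signal `h` bounds `⟪h, g⟫` from below in terms of `⟪g, H g⟫`
and `⟪h, H h⟫`. The latter is small because `f` is Hölder continuous, and
`‖H‖ ≤ 4 λ k cos² (π / (2 n))` because the edges `{i, i + d}` of the nearest neighbour graph, for a
fixed `d ≤ k`, form disjoint paths.
-/

namespace ModuloDenoise

section TrustRegion

open Metric Submodule

variable {E : Type*} [NormedAddCommGroup E] [InnerProductSpace ℝ E]

theorem norm_apply_sq_le_mul_inner {T : E →ₗ[ℝ] E} (hT : T.IsPositive) {c : ℝ}
    (hc : ∀ x, inner ℝ x (T x) ≤ c * ‖x‖ ^ 2) (x : E) : ‖T x‖ ^ 2 ≤ c * inner ℝ x (T x) := by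
  rcases eq_or_ne (T x) 0 with h0 | h0
  · simp [h0]
  have cauchySchwarz : (‖T x‖ ^ 2) ^ 2 ≤ inner ℝ x (T x) * inner ℝ (T x) (T (T x)) := by
    have h := LinearMap.BilinForm.apply_mul_apply_le_of_forall_zero_le
      ((innerₗ E).compl₂ T) (fun y => by simpa using hT.inner_nonneg_right y) x (T x)
    simp only [LinearMap.compl₂_apply, innerₗ_apply_apply, ← hT.isSymmetric x (T x),
      real_inner_self_eq_norm_sq] at h
    rwa [sq]
  have h : (‖T x‖ ^ 2) * ‖T x‖ ^ 2 ≤ c * inner ℝ x (T x) * ‖T x‖ ^ 2 := by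
    linarith [mul_le_mul_of_nonneg_left (hc (T x)) (hT.inner_nonneg_right x)]
  exact le_of_mul_le_mul_right h (by positivity)

theorem norm_apply_le_mul_norm {T : E →ₗ[ℝ] E} (hT : T.IsPositive) {c : ℝ}
    (hc : ∀ x, inner ℝ x (T x) ≤ c * ‖x‖ ^ 2) (x : E) : ‖T x‖ ≤ c * ‖x‖ := by
  rcases eq_or_ne x 0 with rfl | hx
  · simp
  have hc0 : 0 ≤ c :=
    nonneg_of_mul_nonneg_left ((hT.inner_nonneg_right x).trans (hc x)) (by positivity)
  refine abs_le_of_sq_le_sq' ?_ (by positivity) |>.2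
  calc ‖T x‖ ^ 2 ≤ c * inner ℝ x (T x) := norm_apply_sq_le_mul_inner hT hc x
    _ ≤ c * (c * ‖x‖ ^ 2) := by gcongr; exact hc x
    _ = (c * ‖x‖) ^ 2 := by ring

/-- The objective `⟪x, T x⟫ - 2 ⟪x, z⟫` of the trust-region problem of an operator `T`; on
`EuclideanSpace ℝ (Fin n ⊕ Fin n)` it specializes to `objective`. -/
def quadObjective (T : E →ₗ[ℝ] E) (z x : E) : ℝ := inner ℝ x (T x) - 2 * inner ℝ x z

theorem hasStrictFDerivAt_quadObjective [CompleteSpace E] {T : E →ₗ[ℝ] E} (hT : T.IsSymmetric)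
    (z x : E) : HasStrictFDerivAt (quadObjective T z) (2 • innerSL ℝ (T x - z)) x := by
  let S : E →L[ℝ] E := hT.toSelfAdjoint
  have hquad := LinearMap.IsSymmetric.hasStrictFDerivAt_reApplyInnerSelf (T := S) hT x
  have hlin := ((innerSL ℝ z).hasStrictFDerivAt (x := x)).const_mul 2
  convert! hquad.sub hlin using 1
  · ext y
    simp only [quadObjective, ContinuousLinearMap.reApplyInnerSelf, Pi.sub_apply,
      coe_innerSL_apply, real_inner_comm, RCLike.re_to_real, sub_left_inj]
    rfl
  · ext y
    simp only [map_sub, smul_apply, sub_apply, coe_innerSL_apply, nsmul_eq_mul, mul_sub,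
      Nat.cast_ofNat, smul_eq_mul, sub_left_inj, mul_eq_mul_left_iff, OfNat.ofNat_ne_zero, or_false]
    rfl

theorem exists_multiplier_of_isMinOn_sphere [CompleteSpace E] {T : E →ₗ[ℝ] E}
    (hT : T.IsSymmetric) {z g : E} (hg : g ≠ 0)
    (hmin : IsMinOn (quadObjective T z) (sphere 0 ‖g‖) g) : ∃ μ : ℝ, T g + μ • g = z := by
  have hextr : IsLocalExtrOn (quadObjective T z) {x | ‖x‖ ^ 2 = ‖g‖ ^ 2} g := by
    have hsphere : {x : E | ‖x‖ ^ 2 = ‖g‖ ^ 2} = sphere 0 ‖g‖ := by ext x; simp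
    exact hsphere ▸ hmin.localize.isExtr
  obtain ⟨a, b, hab, h⟩ := hextr.exists_multipliers_of_hasStrictFDerivAt_1d
    (hasStrictFDerivAt_norm_sq g) (hasStrictFDerivAt_quadObjective hT z g)
  have hgrad : a • g + b • (T g - z) = 0 := by
    apply ext_inner_right ℝ
    intro y
    have := congrArg (fun L : E →L[ℝ] ℝ => L y) h
    simp only [map_sub, add_apply, sub_apply, smul_apply, zero_apply, coe_innerSL_apply,
      nsmul_eq_mul, Nat.cast_ofNat, smul_eq_mul] at this
    simp only [inner_add_left, inner_sub_left, inner_smul_left, inner_zero_left,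
      RCLike.conj_to_real]
    linarith
  have hb : b ≠ 0 := by
    rintro rfl
    have ha : a = 0 := by simpa [hg] using hgrad
    exact hab (by rw [ha]; rfl)
  refine ⟨a / b, ?_⟩
  have : b • (T g + (a / b) • g - z) = 0 := by
    rw [← hgrad, smul_sub, smul_add, smul_smul, mul_div_cancel₀ _ hb, smul_sub]
    abel
  exact sub_eq_zero.1 ((smul_eq_zero.1 this).resolve_left hb)

theorem quadObjective_eq_add_of_multiplier {T : E →ₗ[ℝ] E} (hT : T.IsSymmetric) {z g : E} {μ : ℝ}
    (hμ : T g + μ • g = z) {x : E} (hx : ‖x‖ = ‖g‖) :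
    quadObjective T z x
      = quadObjective T z g + (inner ℝ (x - g) (T (x - g)) + μ * ‖x - g‖ ^ 2) := by
  have hcross : inner ℝ g (T x) = inner ℝ x (T g) := by rw [← hT g x, real_inner_comm]
  simp only [quadObjective, ← hμ, map_sub, inner_sub_left, inner_sub_right, inner_add_right,
    inner_smul_right, norm_sub_sq_real, hx, hcross, real_inner_self_eq_norm_sq]
  ring

theorem dense_setOf_inner_ne_zero {g : E} (hg : g ≠ 0) : Dense {y : E | inner ℝ g y ≠ 0} := by
  have hker : ({y : E | inner ℝ g y ≠ 0} : Set E) = ((ℝ ∙ g)ᗮ : Set E)ᶜ := by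
    ext y
    simp [mem_orthogonal_singleton_iff_inner_right]
  rw [hker, ← interior_eq_empty_iff_dense_compl, Set.eq_empty_iff_forall_notMem]
  intro x hx
  have htop := eq_top_of_nonempty_interior' _ ⟨x, hx⟩
  have : g ∈ (ℝ ∙ g)ᗮ := htop ▸ mem_top
  exact hg (inner_self_eq_zero.1 (mem_orthogonal_singleton_iff_inner_right.1 this))

theorem inner_apply_add_multiplier_nonneg {T : E →ₗ[ℝ] E} (hT : T.IsSymmetric)
    (hTc : Continuous T) {z g : E} (hg : g ≠ 0)
    (hmin : IsMinOn (quadObjective T z) (sphere 0 ‖g‖) g) {μ : ℝ} (hμ : T g + μ • g = z) (x : E) :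
    0 ≤ inner ℝ x (T x) + μ * ‖x‖ ^ 2 := by
  have hclosed : IsClosed {y : E | 0 ≤ inner ℝ y (T y) + μ * ‖y‖ ^ 2} :=
    isClosed_le continuous_const (by fun_prop)
  refine hclosed.closure_subset_iff.2 (fun y hy => ?_) (dense_setOf_inner_ne_zero hg x)
  have hrefl : reflection (ℝ ∙ y)ᗮ g - g = -(2 * (inner ℝ y g / ‖y‖ ^ 2)) • y := by
    rw [reflection_orthogonal_apply, reflection_singleton_apply, RCLike.ofReal_real_eq_id, id]
    module
  have hy0 : y ≠ 0 := by
    rintro rfl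
    exact hy (inner_zero_right g)
  -- The reflected minimizer differs from `g` by a nonzero multiple of `y`.
  set t := -(2 * (inner ℝ y g / ‖y‖ ^ 2)) with ht
  have ht0 : t ≠ 0 := by
    have hyg : inner ℝ y g ≠ 0 := by rwa [real_inner_comm]
    simp [ht, hyg, hy0]
  have hnorm : ‖reflection (ℝ ∙ y)ᗮ g‖ = ‖g‖ := LinearIsometryEquiv.norm_map _ _
  have hle := hmin (mem_sphere_zero_iff_norm.2 hnorm)
  rw [Set.mem_ofPred_eq, quadObjective_eq_add_of_multiplier hT hμ hnorm, hrefl] at hle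
  simp only [map_smul, inner_smul_left, inner_smul_right, norm_smul, mul_pow, Real.norm_eq_abs,
    sq_abs, RCLike.conj_to_real] at hle
  refine nonneg_of_mul_nonneg_right (b := inner ℝ y (T y) + μ * ‖y‖ ^ 2) ?_
    (sq_pos_of_ne_zero ht0)
  linarith

theorem eq_of_quadObjective_le {T : E →ₗ[ℝ] E} (hT : T.IsPositive) {z g x : E} {μ : ℝ}
    (hμ0 : 0 < μ) (hμ : T g + μ • g = z) (hx : ‖x‖ = ‖g‖)
    (hle : quadObjective T z x ≤ quadObjective T z g) : x = g := by
  rw [quadObjective_eq_add_of_multiplier hT.isSymmetric hμ hx] at hle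
  have hsq : μ * ‖x - g‖ ^ 2 ≤ 0 := by linarith [hT.inner_nonneg_right (x - g)]
  simpa [sub_eq_zero] using (nonpos_of_mul_nonpos_right hsq hμ0).antisymm (sq_nonneg _)

theorem multiplier_le_one {T : E →ₗ[ℝ] E} (hT : T.IsPositive) {z g : E} (hg : g ≠ 0) {μ : ℝ}
    (hμ : T g + μ • g = z) (hzg : ‖z‖ ≤ ‖g‖) : μ ≤ 1 := by
  refine le_of_mul_le_mul_right (a := ‖g‖ ^ 2) ?_ (by positivity)
  calc μ * ‖g‖ ^ 2 ≤ inner ℝ g (T g) + μ * ‖g‖ ^ 2 := by linarith [hT.inner_nonneg_right g]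
    _ = inner ℝ g z := by
      rw [← hμ, inner_add_right, inner_smul_right, real_inner_self_eq_norm_sq]
    _ ≤ ‖g‖ * ‖z‖ := real_inner_le_norm g z
    _ ≤ 1 * ‖g‖ ^ 2 := by nlinarith [norm_nonneg g]

theorem inner_apply_le_mul_of_multiplier {T : E →ₗ[ℝ] E} (hT : T.IsPositive) {c : ℝ}
    (hc : ∀ x, inner ℝ x (T x) ≤ c * ‖x‖ ^ 2) {z g : E} (hg : g ≠ 0) {μ : ℝ} (hμ0 : 0 ≤ μ)
    (hμ : T g + μ • g = z) (hzg : ‖z‖ ≤ ‖g‖) :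
    inner ℝ z (T z) ≤ (c + 1) ^ 2 * inner ℝ g (T g) := by
  have hc0 : 0 ≤ c :=
    nonneg_of_mul_nonneg_left ((hT.inner_nonneg_right g).trans (hc g)) (by positivity)
  have hpos := hT.inner_nonneg_right g
  have hTg := norm_apply_sq_le_mul_inner hT hc g
  have hexpand : inner ℝ z (T z)
      = inner ℝ (T g) (T (T g)) + 2 * μ * ‖T g‖ ^ 2 + μ ^ 2 * inner ℝ g (T g) := by
    simp only [← hμ, map_add, map_smul, inner_add_left, inner_add_right, inner_smul_left,
      inner_smul_right, ← hT.isSymmetric g (T g), real_inner_self_eq_norm_sq,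
      RCLike.conj_to_real]
    ring
  have hμ1 := multiplier_le_one hT hg hμ hzg
  calc inner ℝ z (T z)
      ≤ c * ‖T g‖ ^ 2 + 2 * μ * ‖T g‖ ^ 2 + μ ^ 2 * inner ℝ g (T g) := by
        rw [hexpand]; gcongr; exact hc _
    _ ≤ c * (c * inner ℝ g (T g)) + 2 * μ * (c * inner ℝ g (T g)) + μ ^ 2 * inner ℝ g (T g) := by
        gcongr
    _ = (c + μ) ^ 2 * inner ℝ g (T g) := by ring
    _ ≤ (c + 1) ^ 2 * inner ℝ g (T g) := by gcongr

theorem exists_pos_multiplier [FiniteDimensional ℝ E] {T : E →ₗ[ℝ] E} (hT : T.IsSymmetric)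
    {z g v : E} (hg : g ≠ 0) (hmin : IsMinOn (quadObjective T z) (sphere 0 ‖g‖) g)
    (hv : v ≠ 0) (hTv : T v = 0) (hTg : T g ≠ z) : ∃ μ : ℝ, 0 < μ ∧ T g + μ • g = z := by
  have := FiniteDimensional.complete ℝ E
  obtain ⟨μ, hμ⟩ := exists_multiplier_of_isMinOn_sphere hT hg hmin
  have hnonneg : 0 ≤ μ * ‖v‖ ^ 2 := by
    simpa [hTv] using
      inner_apply_add_multiplier_nonneg hT T.continuous_of_finiteDimensional hg hmin hμ v
  have hμ0 : 0 ≤ μ := nonneg_of_mul_nonneg_left hnonneg (by positivity)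
  refine ⟨μ, hμ0.lt_of_ne ?_, hμ⟩
  rintro rfl
  exact hTg (by simpa using hμ)

theorem exists_isMinOn_sphere_unique [FiniteDimensional ℝ E] {T : E →ₗ[ℝ] E}
    (hT : T.IsPositive) {c : ℝ} (hc : ∀ x, inner ℝ x (T x) ≤ c * ‖x‖ ^ 2) {z v : E} (hz : z ≠ 0)
    (hv : v ≠ 0) (hTv : T v = 0) (hne : ∀ g ∈ sphere (0 : E) ‖z‖, T g ≠ z) :
    ∃ g ∈ sphere (0 : E) ‖z‖, IsMinOn (quadObjective T z) (sphere 0 ‖z‖) g ∧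
      (∀ x ∈ sphere (0 : E) ‖z‖, quadObjective T z x ≤ quadObjective T z g → x = g) ∧
      inner ℝ z (T z) ≤ (c + 1) ^ 2 * inner ℝ g (T g) := by
  have := FiniteDimensional.proper ℝ E
  have hTc : Continuous T := T.continuous_of_finiteDimensional
  obtain ⟨g, hgs, hmin⟩ := (isCompact_sphere (0 : E) ‖z‖).exists_isMinOn
    ⟨z, mem_sphere_zero_iff_norm.2 rfl⟩ (f := quadObjective T z)
    (by unfold quadObjective; fun_prop)
  have hgz : ‖g‖ = ‖z‖ := mem_sphere_zero_iff_norm.1 hgs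
  have hg : g ≠ 0 := by rwa [← norm_ne_zero_iff, hgz, norm_ne_zero_iff]
  obtain ⟨μ, hμ0, hμ⟩ := exists_pos_multiplier hT.isSymmetric hg (hgz ▸ hmin) hv hTv (hne g hgs)
  refine ⟨g, hgs, hmin, fun x hx hle => ?_,
    inner_apply_le_mul_of_multiplier hT hc hg hμ0.le hμ hgz.ge⟩
  exact eq_of_quadObjective_le hT hμ0 hμ ((mem_sphere_zero_iff_norm.1 hx).trans hgz.symm) hle

theorem apply_ne_of_notMem_ker_orthogonal {T : E →ₗ[ℝ] E} (hT : T.IsSymmetric) {z : E}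
    (hz : z ∉ (LinearMap.ker T)ᗮ) (g : E) : T g ≠ z := by
  rintro rfl
  refine hz fun v hv => ?_
  rw [← hT v g, LinearMap.mem_ker.1 hv, inner_zero_left]

theorem apply_ne_of_mem_sphere {T : E →ₗ[ℝ] E} (hT : T.IsPositive) {c : ℝ}
    (hc : ∀ x, inner ℝ x (T x) ≤ c * ‖x‖ ^ 2) (hc1 : c < 1) {z g : E} (hz : z ≠ 0)
    (hg : g ∈ sphere (0 : E) ‖z‖) : T g ≠ z := by
  rintro rfl
  have hle := norm_apply_le_mul_norm hT hc g
  rw [mem_sphere_zero_iff_norm.1 hg] at hle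
  exact hle.not_gt (mul_lt_of_lt_one_left (norm_pos_iff.2 hz) hc1)

theorem le_inner_of_quadObjective_le {T : E →ₗ[ℝ] E} {h z g : E} {δ : ℝ} (hδ : δ ≤ 1)
    (hh : ‖h‖ = ‖z‖) (hg : ‖g‖ = ‖z‖) (hzh : ‖z - h‖ ≤ δ * ‖z‖)
    (hle : quadObjective T z g ≤ quadObjective T z h) :
    ‖z‖ ^ 2 * (1 - 3 * δ / 2) - inner ℝ h (T h) / 2 + inner ℝ g (T g) / 2 ≤ inner ℝ h g := by
  have hcomp : inner ℝ g (T g) - 2 * inner ℝ g z ≤ inner ℝ h (T h) - 2 * inner ℝ h z := hle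
  have hnear : ‖z‖ ^ 2 * (1 - δ / 2) ≤ inner ℝ h z := by
    have hsq : ‖z - h‖ ^ 2 ≤ δ * ‖z‖ ^ 2 := by
      have hδ0 : 0 ≤ δ * ‖z‖ := (norm_nonneg _).trans hzh
      calc ‖z - h‖ ^ 2 ≤ δ * (δ * ‖z‖ * ‖z‖) := by
            nlinarith [pow_le_pow_left₀ (norm_nonneg _) hzh 2]
        _ ≤ 1 * (δ * ‖z‖ * ‖z‖) := by gcongr
        _ = δ * ‖z‖ ^ 2 := by ring
    rw [norm_sub_sq_real, hh, real_inner_comm] at hsq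
    linarith
  have hfar : inner ℝ g z - inner ℝ h g ≤ δ * ‖z‖ ^ 2 := by
    calc inner ℝ g z - inner ℝ h g = inner ℝ (z - h) g := by
          rw [inner_sub_left, real_inner_comm]
      _ ≤ ‖z - h‖ * ‖g‖ := real_inner_le_norm _ _
      _ ≤ δ * ‖z‖ * ‖z‖ := by rw [hg]; gcongr
      _ = δ * ‖z‖ ^ 2 := by ring
  linarith

end TrustRegion

section Path

open Real Finset

/-- The top eigenvector, up to alternating signs, of the Laplacian of the path on `n` vertices. -/
noncomputable def pathWeight (n t : ℕ) : ℝ := sin ((2 * t + 1) * (π / (2 * n)))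

/-- The coefficient with which the edge from `t` to `t + 1` is charged to its left end when its
squared length is split between its ends according to the weights. -/
noncomputable def leftCharge (n t : ℕ) : ℝ := 1 + pathWeight n (t + 1) / pathWeight n t

theorem pathWeight_pos {n t : ℕ} (ht : t < n) : 0 < pathWeight n t := by
  have hn : (0 : ℝ) < n := by exact_mod_cast (Nat.zero_le t).trans_lt ht
  have ht' : (t : ℝ) + 1 ≤ n := by exact_mod_cast ht
  refine sin_pos_of_pos_of_lt_pi (by positivity) ?_
  calc (2 * t + 1) * (π / (2 * n)) < 2 * n * (π / (2 * n)) := by gcongr; linarith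
    _ = π := by field_simp

theorem pathWeight_add_pathWeight (n t : ℕ) :
    pathWeight n t + pathWeight n (t + 2)
      = (4 * cos (π / (2 * n)) ^ 2 - 2) * pathWeight n (t + 1) := by
  set θ := π / (2 * n) with hθ
  have hleft : (2 * (t : ℝ) + 1) * θ = (2 * (t + 1 : ℕ) + 1) * θ - 2 * θ := by push_cast; ring
  have hright : (2 * ((t + 2 : ℕ) : ℝ) + 1) * θ = (2 * (t + 1 : ℕ) + 1) * θ + 2 * θ := by
    push_cast; ring
  rw [pathWeight, pathWeight, pathWeight, ← hθ, hleft, hright, sin_sub, sin_add, cos_two_mul]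
  ring

theorem pathWeight_add_succ_nonneg {n t : ℕ} (ht : t < n) :
    0 ≤ pathWeight n t + pathWeight n (t + 1) := by
  have hn : (1 : ℝ) ≤ n := by exact_mod_cast (Nat.zero_le t).trans_lt ht
  have ht' : (t : ℝ) + 1 ≤ n := by exact_mod_cast ht
  set θ := π / (2 * n) with hθ
  have hθn : 2 * n * θ = π := by rw [hθ]; field_simp
  have hθ0 : 0 < θ := by positivity
  have hsum : pathWeight n t + pathWeight n (t + 1) = 2 * sin ((2 * t + 2) * θ) * cos θ := by
    have hleft : (2 * (t : ℝ) + 1) * θ = (2 * t + 2) * θ - θ := by ring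
    have hright : (2 * ((t + 1 : ℕ) : ℝ) + 1) * θ = (2 * t + 2) * θ + θ := by push_cast; ring
    rw [pathWeight, pathWeight, ← hθ, hleft, hright, sin_sub, sin_add]
    ring
  have hsin : 0 ≤ sin ((2 * t + 2) * θ) :=
    sin_nonneg_of_nonneg_of_le_pi (by positivity) (by rw [← hθn]; gcongr; linarith)
  have hcos : 0 ≤ cos θ := cos_nonneg_of_mem_Icc ⟨by linarith [pi_pos], by nlinarith⟩
  rw [hsum]
  positivity

theorem leftCharge_nonneg {n t : ℕ} (ht : t < n) : 0 ≤ leftCharge n t := by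
  rw [leftCharge, one_add_div (pathWeight_pos ht).ne']
  exact div_nonneg (pathWeight_add_succ_nonneg ht) (pathWeight_pos ht).le

theorem leftCharge_zero {n : ℕ} (hn : 0 < n) : leftCharge n 0 = 4 * cos (π / (2 * n)) ^ 2 := by
  have h0 := (pathWeight_pos hn).ne'
  have h1 : pathWeight n 1 = (4 * cos (π / (2 * n)) ^ 2 - 1) * pathWeight n 0 := by
    simp only [pathWeight, Nat.cast_one, Nat.cast_zero, mul_zero, zero_add, one_mul, mul_one]
    rw [show (2 : ℝ) + 1 = 3 by norm_num, sin_three_mul, cos_sq']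
    ring
  rw [leftCharge, h1, mul_div_cancel_right₀ _ h0]
  ring

theorem one_add_pathWeight_div_succ {n t : ℕ} (ht : t + 1 < n) :
    1 + pathWeight n t / pathWeight n (t + 1)
      = 4 * cos (π / (2 * n)) ^ 2 - leftCharge n (t + 1) := by
  have h := (pathWeight_pos ht).ne'
  rw [leftCharge]
  field_simp
  linear_combination pathWeight_add_pathWeight n t

variable {E : Type*} [SeminormedAddCommGroup E]

theorem norm_sub_sq_le_add_div {a b : ℝ} (ha : 0 < a) (hb : 0 < b) (x y : E) :
    ‖x - y‖ ^ 2 ≤ (1 + b / a) * ‖x‖ ^ 2 + (1 + a / b) * ‖y‖ ^ 2 := by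
  have hcross : 2 * ‖x‖ * ‖y‖ ≤ b / a * ‖x‖ ^ 2 + a / b * ‖y‖ ^ 2 := by
    have h : b / a * ‖x‖ ^ 2 + a / b * ‖y‖ ^ 2 - 2 * ‖x‖ * ‖y‖
        = (b * ‖x‖ - a * ‖y‖) ^ 2 / (a * b) := by
      field_simp
      ring
    have : 0 ≤ (b * ‖x‖ - a * ‖y‖) ^ 2 / (a * b) := by positivity
    linarith
  calc ‖x - y‖ ^ 2 ≤ (‖x‖ + ‖y‖) ^ 2 := by gcongr; exact norm_sub_le x y
    _ ≤ _ := by linarith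

theorem norm_sub_sq_le_leftCharge {n t : ℕ} (ht : t + 1 < n) (x y : E) :
    ‖x - y‖ ^ 2 ≤ leftCharge n t * ‖x‖ ^ 2
      + (4 * cos (π / (2 * n)) ^ 2 - leftCharge n (t + 1)) * ‖y‖ ^ 2 := by
  rw [← one_add_pathWeight_div_succ ht]
  exact norm_sub_sq_le_add_div (pathWeight_pos (t.lt_succ_self.trans ht)) (pathWeight_pos ht) x y

theorem sum_range_sub_shift_le {n d : ℕ} (hd : d ≤ n) {Q : ℕ → ℝ} (hQ : ∀ j < n, 0 ≤ Q j) :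
    ∑ j ∈ range (n - d), (Q j - Q (d + j)) ≤ ∑ j ∈ range d, Q j := by
  have hsplit := sum_range_add Q d (n - d)
  rw [Nat.add_sub_cancel' hd] at hsplit
  have hle : ∑ j ∈ range (n - d), Q j ≤ ∑ j ∈ range n, Q j :=
    sum_le_sum_of_subset_of_nonneg (range_mono (n.sub_le d)) fun j hj _ => hQ j (mem_range.1 hj)
  rw [sum_sub_distrib]
  linarith

/- The differences `x j - x (j + d)` run along `d` disjoint paths, one for each residue class
modulo `d`, on which `j / d` is the position. -/
theorem sum_norm_sub_shift_sq_le (n d : ℕ) (x : ℕ → E) :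
    ∑ j ∈ range (n - d), ‖x j - x (j + d)‖ ^ 2
      ≤ 4 * cos (π / (2 * n)) ^ 2 * ∑ j ∈ range n, ‖x j‖ ^ 2 := by
  rcases Nat.eq_zero_or_pos d with rfl | hd
  · simp only [add_zero, sub_self, norm_zero, zero_pow two_ne_zero, sum_const_zero]
    positivity
  rcases le_or_gt n d with hnd | hnd
  · rw [Nat.sub_eq_zero_of_le hnd, range_zero, sum_empty]
    positivity
  set C := 4 * cos (π / (2 * n)) ^ 2
  let Q : ℕ → ℝ := fun j => leftCharge n (j / d) * ‖x j‖ ^ 2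
  have hQ : ∀ j < n, 0 ≤ Q j := fun j hj =>
    mul_nonneg (leftCharge_nonneg ((Nat.div_le_self _ _).trans_lt hj)) (sq_nonneg _)
  have hedge : ∀ j ∈ range (n - d),
      ‖x j - x (j + d)‖ ^ 2 ≤ (Q j - Q (d + j)) + C * ‖x (d + j)‖ ^ 2 := by
    intro j hj
    have hdiv : (d + j) / d = j / d + 1 := Nat.add_div_left j hd
    have hlt : j / d + 1 < n :=
      hdiv ▸ (Nat.div_le_self _ _).trans_lt (by have := mem_range.1 hj; omega)
    have h := norm_sub_sq_le_leftCharge hlt (x j) (x (d + j))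
    simp only [Q, hdiv, add_comm j d]
    linarith
  have hstart : ∑ j ∈ range d, Q j = C * ∑ j ∈ range d, ‖x j‖ ^ 2 := by
    rw [mul_sum]
    refine sum_congr rfl fun j hj => ?_
    simp only [Q, Nat.div_eq_of_lt (mem_range.1 hj), leftCharge_zero (hd.trans hnd), C]
  calc ∑ j ∈ range (n - d), ‖x j - x (j + d)‖ ^ 2
      ≤ ∑ j ∈ range (n - d), ((Q j - Q (d + j)) + C * ‖x (d + j)‖ ^ 2) := sum_le_sum hedge
    _ ≤ C * ∑ j ∈ range d, ‖x j‖ ^ 2 + C * ∑ j ∈ range (n - d), ‖x (d + j)‖ ^ 2 := by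
      rw [sum_add_distrib, ← mul_sum, ← hstart]
      gcongr
      exact sum_range_sub_shift_le hnd.le hQ
    _ = C * ∑ j ∈ range n, ‖x j‖ ^ 2 := by
      rw [← mul_add, ← sum_range_add, Nat.add_sub_cancel' hnd.le]

end Path

section Laplacian

open Real Finset

theorem sum_lt_le_add_eq_sum_shift {A : Type*} [AddCommMonoid A] (n k : ℕ) (F : ℕ → ℕ → A) :
    ∑ i ∈ range n, ∑ j ∈ range n, (if i < j ∧ j ≤ i + k then F i j else 0)
      = ∑ d ∈ Icc 1 k, ∑ i ∈ range (n - d), F i (i + d) := by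
  rw [← sum_product', ← sum_filter, sum_sigma']
  refine sum_nbij' (fun p => ⟨p.2 - p.1, p.1⟩) (fun p => (p.2, p.2 + p.1)) ?_ ?_ ?_ ?_ ?_
  · grind
  · grind
  · grind
  · grind
  · grind

theorem sum_nnGraph_adj_eq_sum_shift {A : Type*} [AddCommMonoid A] (n k : ℕ) (F : ℕ → ℕ → A) :
    ∑ i : Fin n, ∑ j : Fin n, (if (nnGraph n k).Adj i j then F i j else 0)
      = ∑ d ∈ Icc 1 k, ∑ i ∈ range (n - d), (F i (i + d) + F (i + d) i) := by
  have hsplit : ∀ i j : Fin n, (if (nnGraph n k).Adj i j then F i j else 0)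
      = (if (i : ℕ) < j ∧ (j : ℕ) ≤ i + k then F i j else 0)
        + (if (j : ℕ) < i ∧ (i : ℕ) ≤ j + k then F i j else 0) := by
    intro i j
    have hadj : (nnGraph n k).Adj i j ↔
        ((i : ℕ) < j ∧ (j : ℕ) ≤ i + k) ∨ ((j : ℕ) < i ∧ (i : ℕ) ≤ j + k) := by
      change (i ≠ j ∧ |((i : ℕ) : ℤ) - ((j : ℕ) : ℤ)| ≤ (k : ℤ)) ↔ _
      rw [abs_le]
      omega
    grind
  have hrange : ∀ G : ℕ → ℕ → A,
      ∑ i : Fin n, ∑ j : Fin n, G i j = ∑ i ∈ range n, ∑ j ∈ range n, G i j := fun G => by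
    rw [← Fin.sum_univ_eq_sum_range (fun i => ∑ j ∈ range n, G i j)]
    exact sum_congr rfl fun i _ => Fin.sum_univ_eq_sum_range (fun j => G i j) n
  simp only [hsplit, sum_add_distrib]
  rw [hrange fun i j => if i < j ∧ j ≤ i + k then F i j else 0,
    hrange fun i j => if j < i ∧ i ≤ j + k then F i j else 0,
    sum_comm (f := fun i j => if j < i ∧ i ≤ j + k then F i j else 0),
    sum_lt_le_add_eq_sum_shift, sum_lt_le_add_eq_sum_shift n k fun i j => F j i]

theorem norm_realify_sq {n : ℕ} (g : Fin n → ℂ) : ‖realify g‖ ^ 2 = ∑ i, ‖g i‖ ^ 2 := by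
  rw [EuclideanSpace.norm_sq_eq, Fintype.sum_sum_type, ← sum_add_distrib]
  refine sum_congr rfl fun i _ => ?_
  rw [Complex.sq_norm, Complex.normSq_apply, ← sq, ← sq]
  simp only [realify, Sum.elim_inl, Sum.elim_inr, Real.norm_eq_abs, sq_abs]

theorem exists_realify_eq {n : ℕ} (g : EuclideanSpace ℝ (Fin n ⊕ Fin n)) :
    ∃ x : ℕ → ℂ, realify (fun i : Fin n => x i) = g := by
  let x : Fin n → ℂ := fun i => ⟨g (Sum.inl i), g (Sum.inr i)⟩
  refine ⟨Function.extend Fin.val x 0, ?_⟩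
  ext (i | i) <;> simp [realify, Fin.val_injective.extend_apply, x]

theorem quadForm_regMatrix_realify {n : ℕ} (k : ℕ) (lam : ℝ) (g : Fin n → ℂ) :
    quadForm (regMatrix n k lam) (realify g)
      = lam * ((∑ i, ∑ j, if (nnGraph n k).Adj i j then ‖g i - g j‖ ^ 2 else 0) / 2) := by
  have hlap := (nnGraph n k).lapMatrix_toLinearMap₂' ℝ
  have hnorm : ∀ i j, (if (nnGraph n k).Adj i j then ‖g i - g j‖ ^ 2 else 0)
      = (if (nnGraph n k).Adj i j then ((g i).re - (g j).re) ^ 2 else 0)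
        + (if (nnGraph n k).Adj i j then ((g i).im - (g j).im) ^ 2 else 0) := fun i j => by
    rw [Complex.sq_norm, Complex.normSq_apply, Complex.sub_re, Complex.sub_im, ← sq, ← sq]
    split_ifs <;> simp
  simp only [hnorm, sum_add_distrib, add_div]
  rw [← hlap fun i => (g i).re, ← hlap fun i => (g i).im,
    Matrix.toLinearMap₂'_apply', Matrix.toLinearMap₂'_apply', quadForm,
    EuclideanSpace.inner_eq_star_dotProduct, Matrix.ofLp_toLpLin, Matrix.toLin'_apply, star_trivial,
    dotProduct_comm, regMatrix, Matrix.fromBlocks_mulVec, mul_add]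
  simp only [realify, dotProduct, Fintype.sum_sum_type, Matrix.smul_mulVec, Matrix.zero_mulVec,
    add_zero, zero_add, Sum.elim_inl, Sum.elim_inr, Sum.elim_comp_inl, Sum.elim_comp_inr,
    Pi.smul_apply, smul_eq_mul, mul_sum, mul_left_comm lam]

theorem quadForm_regMatrix_realify_eq_sum_shift (n k : ℕ) (lam : ℝ) (x : ℕ → ℂ) :
    quadForm (regMatrix n k lam) (realify fun i => x i)
      = lam * ∑ d ∈ Icc 1 k, ∑ j ∈ range (n - d), ‖x j - x (j + d)‖ ^ 2 := by
  rw [quadForm_regMatrix_realify, sum_nnGraph_adj_eq_sum_shift n k fun i j => ‖x i - x j‖ ^ 2]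
  simp only [norm_sub_rev (x (_ + _)), ← two_mul, ← mul_sum]
  rw [mul_div_cancel_left₀ _ two_ne_zero]

theorem isPositive_regMatrix (n k : ℕ) {lam : ℝ} (hlam : 0 ≤ lam) :
    (Matrix.toEuclideanLin (regMatrix n k lam)).IsPositive := by
  refine ⟨?_, fun g => ?_⟩
  · have hblock : (lam • (nnGraph n k).lapMatrix ℝ).IsHermitian :=
      ((nnGraph n k).isHermitian_lapMatrix ℝ).smul (IsSelfAdjoint.all lam)
    exact Matrix.isSymmetric_toEuclideanLin_iff.2
      (hblock.fromBlocks Matrix.conjTranspose_zero hblock)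
  · obtain ⟨x, rfl⟩ := exists_realify_eq g
    rw [RCLike.re_to_real, real_inner_comm]
    change 0 ≤ quadForm _ _
    rw [quadForm_regMatrix_realify_eq_sum_shift]
    positivity

theorem quadForm_regMatrix_le (n k : ℕ) {lam : ℝ} (hlam : 0 ≤ lam)
    (g : EuclideanSpace ℝ (Fin n ⊕ Fin n)) :
    quadForm (regMatrix n k lam) g ≤ 4 * lam * k * cos (π / (2 * n)) ^ 2 * ‖g‖ ^ 2 := by
  obtain ⟨x, rfl⟩ := exists_realify_eq g
  rw [quadForm_regMatrix_realify_eq_sum_shift, norm_realify_sq,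
    Fin.sum_univ_eq_sum_range fun i => ‖x i‖ ^ 2]
  calc lam * ∑ d ∈ Icc 1 k, ∑ j ∈ range (n - d), ‖x j - x (j + d)‖ ^ 2
      ≤ lam * ∑ d ∈ Icc 1 k, 4 * cos (π / (2 * n)) ^ 2 * ∑ j ∈ range n, ‖x j‖ ^ 2 := by
        gcongr with d
        exact sum_norm_sub_shift_sq_le n d x
    _ = 4 * lam * k * cos (π / (2 * n)) ^ 2 * ∑ j ∈ range n, ‖x j‖ ^ 2 := by
        rw [sum_const, Nat.card_Icc, Nat.add_sub_cancel, nsmul_eq_mul]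
        ring

theorem quadForm_regMatrix_le_of_forall_adj {n k : ℕ} {lam b : ℝ} (hlam : 0 ≤ lam) {g : Fin n → ℂ}
    (hg : ∀ i j, (nnGraph n k).Adj i j → ‖g i - g j‖ ≤ b) :
    quadForm (regMatrix n k lam) (realify g) ≤ lam * (k * n * b ^ 2) := by
  rw [quadForm_regMatrix_realify]
  gcongr
  rw [div_le_iff₀ two_pos]
  calc ∑ i, ∑ j, (if (nnGraph n k).Adj i j then ‖g i - g j‖ ^ 2 else 0)
      ≤ ∑ i, ∑ j, (if (nnGraph n k).Adj i j then b ^ 2 else 0) := by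
        gcongr with i _ j
        split_ifs with hij
        · gcongr
          exact hg i j hij
        · rfl
    _ = ∑ d ∈ Icc 1 k, ((n - d : ℕ) : ℝ) * (b ^ 2 + b ^ 2) := by
        rw [sum_nnGraph_adj_eq_sum_shift n k fun _ _ => b ^ 2]
        simp only [sum_const, card_range, nsmul_eq_mul]
    _ ≤ ∑ d ∈ Icc 1 k, (n : ℝ) * (b ^ 2 + b ^ 2) := by
        gcongr
        exact Nat.sub_le _ _
    _ = k * n * b ^ 2 * 2 := by
        rw [sum_const, Nat.card_Icc, Nat.add_sub_cancel, nsmul_eq_mul]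
        ring

theorem exists_ne_zero_regMatrix_apply_eq_zero {n : ℕ} (hn : 0 < n) (k : ℕ) (lam : ℝ) :
    ∃ v : EuclideanSpace ℝ (Fin n ⊕ Fin n), v ≠ 0 ∧
      Matrix.toEuclideanLin (regMatrix n k lam) v = 0 := by
  refine ⟨WithLp.toLp 2 (Sum.elim (fun _ => 1) (fun _ => 1)), fun h => ?_, ?_⟩
  · exact one_ne_zero (congrArg (fun v : EuclideanSpace ℝ (Fin n ⊕ Fin n) => v (Sum.inl ⟨0, hn⟩)) h)
  · rw [Matrix.toLpLin_toLp, Matrix.toLin'_apply, regMatrix, Matrix.fromBlocks_mulVec]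
    simp [Matrix.smul_mulVec, SimpleGraph.lapMatrix_mulVec_const_eq_zero, Function.comp_def]

end Laplacian

section Signal

open Real

theorem norm_exp_two_pi_mul_I_mul (t : ℝ) :
    ‖Complex.exp (2 * π * Complex.I * (t : ℂ))‖ = 1 := by
  rw [show 2 * π * Complex.I * (t : ℂ) = ((2 * π * t : ℝ) : ℂ) * Complex.I by push_cast; ring,
    Complex.norm_exp_ofReal_mul_I]

theorem norm_exp_two_pi_mul_I_mul_sub_le (s t : ℝ) :
    ‖Complex.exp (2 * π * Complex.I * (s : ℂ)) - Complex.exp (2 * π * Complex.I * (t : ℂ))‖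
      ≤ 2 * π * |s - t| := by
  have hfactor :
      Complex.exp (2 * π * Complex.I * (s : ℂ)) - Complex.exp (2 * π * Complex.I * (t : ℂ))
      = Complex.exp (2 * π * Complex.I * (t : ℂ))
        * (Complex.exp (Complex.I * ((2 * π * (s - t) : ℝ) : ℂ)) - 1) := by
    rw [mul_sub, ← Complex.exp_add, mul_one]
    congr 2
    push_cast
    ring
  calc _ = ‖Complex.exp (Complex.I * ((2 * π * (s - t) : ℝ) : ℂ)) - 1‖ := by
        rw [hfactor, norm_mul, norm_exp_two_pi_mul_I_mul, one_mul]
    _ ≤ ‖2 * π * (s - t)‖ := Real.norm_exp_I_mul_ofReal_sub_one_le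
    _ = 2 * π * |s - t| := by rw [Real.norm_eq_abs, abs_mul, abs_of_pos two_pi_pos]

theorem grid_mem_Icc {n : ℕ} (i : Fin n) : grid n i ∈ Set.Icc (0 : ℝ) 1 := by
  have hi : ((i : ℕ) : ℝ) ≤ n - 1 := by
    rw [le_sub_iff_add_le]
    exact_mod_cast i.2
  have hi0 : (0 : ℝ) ≤ (i : ℕ) := Nat.cast_nonneg _
  exact ⟨div_nonneg hi0 (hi0.trans hi), div_le_one_of_le₀ hi (hi0.trans hi)⟩

theorem abs_grid_sub_le {n k : ℕ} (hn : 2 ≤ n) {i j : Fin n} (hij : (nnGraph n k).Adj i j) :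
    |grid n i - grid n j| ≤ 2 * k / n := by
  have hn2 : (2 : ℝ) ≤ n := by exact_mod_cast hn
  have hij' : |((i : ℕ) : ℝ) - ((j : ℕ) : ℝ)| ≤ k := by exact_mod_cast hij.2
  have hn1 : (0 : ℝ) < n - 1 := by linarith
  rw [grid, grid, ← sub_div, abs_div, abs_of_pos hn1, div_le_div_iff₀ hn1 (by linarith)]
  calc |((i : ℕ) : ℝ) - ((j : ℕ) : ℝ)| * n ≤ k * (2 * (n - 1)) := by gcongr; linarith
    _ = 2 * k * (n - 1) := by ring

variable {n k : ℕ} {M α : ℝ} {f : ℝ → ℝ}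

theorem norm_cleanSignal_sub_le (hn : 2 ≤ n) (hα : 0 ≤ α)
    (hf : ∀ x ∈ Set.Icc (0 : ℝ) 1, ∀ y ∈ Set.Icc (0 : ℝ) 1, |f x - f y| ≤ M * |x - y| ^ α)
    {i j : Fin n} (hij : (nnGraph n k).Adj i j) :
    ‖cleanSignal n f i - cleanSignal n f j‖ ≤ 2 * π * (M * (2 * k / n) ^ α) := by
  have hM : 0 ≤ M := by
    simpa using (abs_nonneg _).trans (hf 0 (by simp) 1 (by simp))
  calc ‖cleanSignal n f i - cleanSignal n f j‖
      ≤ 2 * π * |f (grid n i) - f (grid n j)| := norm_exp_two_pi_mul_I_mul_sub_le _ _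
    _ ≤ 2 * π * (M * |grid n i - grid n j| ^ α) := by
        gcongr
        exact hf _ (grid_mem_Icc i) _ (grid_mem_Icc j)
    _ ≤ 2 * π * (M * (2 * k / n) ^ α) := by
        gcongr
        exact abs_grid_sub_le hn hij

theorem quadForm_cleanSignal_le {lam : ℝ} (hn : 2 ≤ n) (hlam : 0 ≤ lam) (hα : 0 ≤ α)
    (hf : ∀ x ∈ Set.Icc (0 : ℝ) 1, ∀ y ∈ Set.Icc (0 : ℝ) 1, |f x - f y| ≤ M * |x - y| ^ α) :
    quadForm (regMatrix n k lam) (realify (cleanSignal n f))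
      ≤ 2 * n * (lam * π ^ 2 * M ^ 2 * (2 * (k : ℝ)) ^ (2 * α + 1) / (n : ℝ) ^ (2 * α)) := by
  have hpow : 2 * k * (((2 * k / n : ℝ)) ^ α) ^ 2
      = (2 * (k : ℝ)) ^ (2 * α + 1) / (n : ℝ) ^ (2 * α) := by
    rw [← rpow_mul_natCast (by positivity), Nat.cast_two, mul_comm α 2,
      div_rpow (by positivity) (by positivity), rpow_add_one' (by positivity) (by positivity)]
    ring
  calc quadForm (regMatrix n k lam) (realify (cleanSignal n f))
      ≤ lam * (k * n * (2 * π * (M * (2 * k / n) ^ α)) ^ 2) :=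
        quadForm_regMatrix_le_of_forall_adj hlam fun _ _ => norm_cleanSignal_sub_le hn hα hf
    _ = 2 * n * (lam * π ^ 2 * M ^ 2 * (2 * k * (((2 * k / n : ℝ)) ^ α) ^ 2)) := by ring
    _ = _ := by rw [hpow]; ring

end Signal

section TrustRegionProblem

open Metric Real

variable {n : ℕ} {H : Matrix (Fin n ⊕ Fin n) (Fin n ⊕ Fin n) ℝ}

theorem isSolution_iff_isMinOn {z g : EuclideanSpace ℝ (Fin n ⊕ Fin n)} (hz : ‖z‖ ^ 2 = n) :
    IsSolution H z g ↔ g ∈ sphere (0 : EuclideanSpace ℝ (Fin n ⊕ Fin n)) ‖z‖ ∧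
      IsMinOn (quadObjective (Matrix.toEuclideanLin H) z) (sphere 0 ‖z‖) g := by
  have hsphere : ∀ x : EuclideanSpace ℝ (Fin n ⊕ Fin n), ‖x‖ ^ 2 = n ↔ x ∈ sphere 0 ‖z‖ := by
    intro x
    rw [← hz, mem_sphere_zero_iff_norm, sq_eq_sq₀ (norm_nonneg x) (norm_nonneg z)]
  simp only [IsSolution, hsphere]
  rfl

theorem norm_realify_cleanSignal_sq (n : ℕ) (f : ℝ → ℝ) : ‖realify (cleanSignal n f)‖ ^ 2 = n := by
  simp [norm_realify_sq, cleanSignal, norm_exp_two_pi_mul_I_mul]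

theorem norm_realify_noisySignal_sq (n : ℕ) (f : ℝ → ℝ) (η : Fin n → ℝ) :
    ‖realify (noisySignal n f η)‖ ^ 2 = n := by
  simp [norm_realify_sq, noisySignal, norm_exp_two_pi_mul_I_mul]

theorem exists_isSolution_unique {k : ℕ} {lam : ℝ} (hn : 0 < n) (hlam : 0 ≤ lam)
    {z : EuclideanSpace ℝ (Fin n ⊕ Fin n)} (hz : ‖z‖ ^ 2 = n)
    (hH : z ∉ (nullSpace (regMatrix n k lam))ᗮ ∨ 4 * lam * k * cos (π / (2 * n)) ^ 2 < 1) :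
    ∃ g, IsSolution (regMatrix n k lam) z g ∧
      (∀ g', IsSolution (regMatrix n k lam) z g' → g' = g) ∧
      quadForm (regMatrix n k lam) z
        ≤ (4 * lam * k * cos (π / (2 * n)) ^ 2 + 1) ^ 2 * quadForm (regMatrix n k lam) g := by
  have hT := isPositive_regMatrix n k hlam
  have hc := quadForm_regMatrix_le n k hlam
  have hz0 : z ≠ 0 := by
    rw [← norm_ne_zero_iff, ← pow_ne_zero_iff two_ne_zero, hz]
    exact_mod_cast hn.ne'
  obtain ⟨v, hv, hTv⟩ := exists_ne_zero_regMatrix_apply_eq_zero hn k lam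
  obtain ⟨g, hgs, hmin, huniq, hquad⟩ := exists_isMinOn_sphere_unique hT hc hz0 hv hTv fun g hg =>
    hH.elim (apply_ne_of_notMem_ker_orthogonal hT.isSymmetric · g)
      (apply_ne_of_mem_sphere hT hc · hz0 hg)
  refine ⟨g, (isSolution_iff_isMinOn hz).2 ⟨hgs, hmin⟩, fun g' hg' => ?_, hquad⟩
  obtain ⟨hgs', hmin'⟩ := (isSolution_iff_isMinOn hz).1 hg'
  exact huniq g' hgs' (hmin' hgs)

theorem le_inner_realify_cleanSignal {k : ℕ} {lam M α δ : ℝ} {f : ℝ → ℝ} (hn : 2 ≤ n)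
    (hlam : 0 ≤ lam) (hα : 0 ≤ α)
    (hf : ∀ x ∈ Set.Icc (0 : ℝ) 1, ∀ y ∈ Set.Icc (0 : ℝ) 1, |f x - f y| ≤ M * |x - y| ^ α)
    (hδ : δ ≤ 1) {z g : EuclideanSpace ℝ (Fin n ⊕ Fin n)} (hz : ‖z‖ ^ 2 = n)
    (hzh : ‖z - realify (cleanSignal n f)‖ ≤ δ * √(n : ℝ))
    (hg : IsSolution (regMatrix n k lam) z g) :
    n * (1 - 3 * δ / 2 - lam * π ^ 2 * M ^ 2 * (2 * (k : ℝ)) ^ (2 * α + 1) / (n : ℝ) ^ (2 * α))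
        + quadForm (regMatrix n k lam) g / 2
      ≤ inner ℝ (realify (cleanSignal n f)) g := by
  have hsqrt : ∀ {x : EuclideanSpace ℝ (Fin n ⊕ Fin n)}, ‖x‖ ^ 2 = n → ‖x‖ = √(n : ℝ) :=
    fun hx => by rw [← hx, sqrt_sq (norm_nonneg _)]
  have hclean := norm_realify_cleanSignal_sq n f
  have hcorr := le_inner_of_quadObjective_le hδ ((hsqrt hclean).trans (hsqrt hz).symm)
    ((hsqrt hg.1).trans (hsqrt hz).symm) ((hsqrt hz).symm ▸ hzh) (hg.2 _ hclean)
  have hsmooth := quadForm_cleanSignal_le (k := k) hn hlam hα hf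
  rw [hz] at hcorr
  simp only [quadForm] at hsmooth ⊢
  linarith

end TrustRegionProblem

end ModuloDenoise

open ModuloDenoise Real in
theorem theorem1_general (n k : ℕ) (hn : 2 ≤ n) (lam : ℝ) (hlam : 0 ≤ lam)
    (M α : ℝ) (hα : 0 ≤ α) (f : ℝ → ℝ)
    (hf : ∀ x ∈ Set.Icc (0 : ℝ) 1, ∀ y ∈ Set.Icc (0 : ℝ) 1, |f x - f y| ≤ M * |x - y| ^ α)
    (δ : ℝ) (hδ : δ ≤ 1) (z : EuclideanSpace ℝ (Fin n ⊕ Fin n)) (hz : ‖z‖ ^ 2 = n)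
    (hzh : ‖z - realify (cleanSignal n f)‖ ≤ δ * √(n : ℝ))
    (hH : z ∉ (nullSpace (regMatrix n k lam))ᗮ ∨ 4 * lam * k * cos (π / (2 * n)) ^ 2 < 1)
    (C : ℝ) (hC : 1 + 4 * lam * k * cos (π / (2 * n)) ^ 2 ≤ C) :
    ∃ g : EuclideanSpace ℝ (Fin n ⊕ Fin n),
      IsSolution (regMatrix n k lam) z g ∧
      (∀ g', IsSolution (regMatrix n k lam) z g' → g' = g) ∧
      1 - 3 * δ / 2 - lam * π ^ 2 * M ^ 2 * (2 * (k : ℝ)) ^ (2 * α + 1) / (n : ℝ) ^ (2 * α)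
          + 1 / C ^ 2 * (1 / (2 * n) * quadForm (regMatrix n k lam) z)
        ≤ 1 / (n : ℝ) * inner ℝ (realify (cleanSignal n f)) g := by
  obtain ⟨g, hg, huniq, hquad⟩ := exists_isSolution_unique (by omega) hlam hz hH
  refine ⟨g, hg, huniq, ?_⟩
  have hcorr := le_inner_realify_cleanSignal hn hlam hα hf hδ hz hzh hg
  have hC0 : 0 < C := lt_of_lt_of_le (by positivity) hC
  have hquadC : quadForm (regMatrix n k lam) z / C ^ 2 ≤ quadForm (regMatrix n k lam) g := by
    rw [div_le_iff₀' (by positivity)]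
    refine hquad.trans (mul_le_mul_of_nonneg_right ?_
      ((isPositive_regMatrix n k hlam).inner_nonneg_right g))
    gcongr
    linarith
  have hn0 : (0 : ℝ) < n := by exact_mod_cast (by omega : 0 < n)
  rw [one_div_mul_eq_div (n : ℝ), le_div_iff₀ hn0]
  set S := lam * π ^ 2 * M ^ 2 * (2 * (k : ℝ)) ^ (2 * α + 1) / (n : ℝ) ^ (2 * α)
  set Q := quadForm (regMatrix n k lam)
  calc (1 - 3 * δ / 2 - S + 1 / C ^ 2 * (1 / (2 * n) * Q z)) * n
      = n * (1 - 3 * δ / 2 - S) + Q z / C ^ 2 / 2 := by field_simp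
    _ ≤ n * (1 - 3 * δ / 2 - S) + Q g / 2 := by gcongr
    _ ≤ inner ℝ (realify (cleanSignal n f)) g := hcorr

theorem theorem1 (n k : ℕ) (hn : 2 ≤ n) (hk : 1 ≤ k) (lam : ℝ) (hlam : 0 ≤ lam)
    (M α : ℝ) (hM : 0 < M) (hα : α ∈ Set.Ioc (0 : ℝ) 1)
    (f : ℝ → ℝ)
    (hf : ∀ x ∈ Set.Icc (0 : ℝ) 1, ∀ y ∈ Set.Icc (0 : ℝ) 1, |f x - f y| ≤ M * |x - y| ^ α)
    (η : Fin n → ℝ) (δ : ℝ) (hδ : δ ∈ Set.Icc (0 : ℝ) 1)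
    (h z : EuclideanSpace ℝ (Fin n ⊕ Fin n))
    (hh : h = ModuloDenoise.realify (ModuloDenoise.cleanSignal n f))
    (hz : z = ModuloDenoise.realify (ModuloDenoise.noisySignal n f η))
    (hzh : ‖z - h‖ ≤ δ * √(n : ℝ))
    (H : Matrix (Fin n ⊕ Fin n) (Fin n ⊕ Fin n) ℝ)
    (hH : H = ModuloDenoise.regMatrix n k lam) :
    (z ∉ (ModuloDenoise.nullSpace H)ᗮ →
      ∃ g : EuclideanSpace ℝ (Fin n ⊕ Fin n),
        ModuloDenoise.IsSolution H z g ∧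
        (∀ g', ModuloDenoise.IsSolution H z g' → g' = g) ∧
        1 - 3 * δ / 2
            - lam * Real.pi ^ 2 * M ^ 2 * (2 * (k : ℝ)) ^ (2 * α + 1) / (n : ℝ) ^ (2 * α)
            + 1 / (4 * lam * k + 1) ^ 2 * (1 / (2 * n) * ModuloDenoise.quadForm H z)
          ≤ 1 / (n : ℝ) * inner ℝ h g) ∧
    (z ∈ (ModuloDenoise.nullSpace H)ᗮ → lam < 1 / (4 * (k : ℝ)) →
      ∃ g : EuclideanSpace ℝ (Fin n ⊕ Fin n),
        ModuloDenoise.IsSolution H z g ∧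
        (∀ g', ModuloDenoise.IsSolution H z g' → g' = g) ∧
        1 - 3 * δ / 2
            - lam * Real.pi ^ 2 * M ^ 2 * (2 * (k : ℝ)) ^ (2 * α + 1) / (n : ℝ) ^ (2 * α)
            + 1 / (1 + 4 * lam * k - 4 * lam * k * Real.sin (Real.pi / (2 * n)) ^ 2) ^ 2
                * (1 / (2 * n) * ModuloDenoise.quadForm H z)
          ≤ 1 / (n : ℝ) * inner ℝ h g) := by
  subst hh hz hH
  have hcos : 4 * lam * k * Real.cos (Real.pi / (2 * n)) ^ 2 ≤ 4 * lam * k :=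
    mul_le_of_le_one_right (by positivity) (Real.cos_sq_le_one _)
  have hnorm := ModuloDenoise.norm_realify_noisySignal_sq n f η
  refine ⟨fun hker => ?_, fun _ hlt => ?_⟩
  · exact theorem1_general n k hn lam hlam M α hα.1.le f hf δ hδ.2 _ hnorm hzh (.inl hker) _
      (by linarith)
  · rw [lt_div_iff₀ (by positivity)] at hlt
    exact theorem1_general n k hn lam hlam M α hα.1.le f hf δ hδ.2 _ hnorm hzh
      (.inr (by linarith)) _ (by rw [Real.cos_sq']; linarith)
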